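/- **Corollary 2.1.** Let $0<p<1$ and $t\in\{0,1,2,\dots\}$. For the discrete-time TASEP with sequential update and jump probability $p$, started from the $d$-periodic configuration $x_k(0)=-d(k-1)$, $k\in\mathbb Z$ (particles on $d\mathbb Z$, $d\ge 2$), the kernel at time $t$ is, for $n_1,x_1,n_2,x_2\in\mathbb Z$, $$K(n_1,x_1;n_2,x_2)=-\binom{x_1-x_2-1}{n_2-n_1-1}+\frac{1}{2\pi i}\oint_{\Gamma_0}dv\sum_{i=1}^{d-1}\frac{1+dv}{1+du_i(v)}\,\frac{(1+pu_i(v))^t(-u_i(v))^{n_1}(1+v)^{x_2+n_2-2}}{(1+pv)^t(-v)^{n_2}(1+u_i(v))^{x_1+n_1-1}},$$ where $\binom mk=0$ unless $0\le k\le m$; where $u_0(v)=v,u_1(v),\dots,u_{d-1}(v)$ are the roots $u$ of $u(1+u)^{d-1}=v(1+v)^{d-1}$, counted with multiplicity; and where $\Gamma_0$ is any simple (piecewise $C^1$) loop, oriented anticlockwise, that encloses $0$ and neither meets nor encloses any other pole of the integrand. Let now $d=2$ (particles on $2\mathbb Z$). Then $u_1(v)=-1-v$ is the only non-trivial root, and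 for all integers $n_1,x_1,n_2,x_2$ $$K(n_1,x_1;n_2,x_2)=-\binom{x_1-x_2-1}{n_2-n_1-1}+\frac{-1}{2\pi i}\oint_{\Gamma_0}dv\,\frac{(1+v)^{x_2+n_1+n_2-2}}{(-v)^{x_1+n_1+n_2-1}}\left(\frac{1-p-pv}{1+pv}\right)^t .$$ Such loops exist, both integrals are well defined, and the identity holds for every choice of a loop $\Gamma_0$ as above on either side. -/

import Mathlib

namespace TasepKernel

noncomputable section

/-! ### Contour integrals over simple loops -/

/-- The path `γ` (parametrized by `[0, 1]`) is piecewise continuously differentiable: there is a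
subdivision `0 = s 0 ≤ s 1 ≤ … ≤ s N = 1` such that `γ` is `C¹` on every `[s i, s (i + 1)]`. -/
def IsPiecewiseC1 {a b : ℂ} (γ : Path a b) : Prop :=
  ∃ (N : ℕ) (s : ℕ → ℝ), Monotone s ∧ s 0 = 0 ∧ s N = 1 ∧
    ∀ i < N, ContDiffOn ℝ 1 γ.extend (Set.Icc (s i) (s (i + 1)))

/-- The contour integral `∮_γ f(z) dz = ∫₀¹ f(γ(s)) γ'(s) ds`. -/
def contourIntegral {a b : ℂ} (f : ℂ → ℂ) (γ : Path a b) : ℂ :=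
  curveIntegral (fun z => ContinuousLinearMap.toSpanSingleton ℂ (f z)) γ

/-- The function `s ↦ f(γ(s)) γ'(s)` is integrable, so that `∮_γ f(z) dz` makes sense. -/
def ContourIntegrable {a b : ℂ} (f : ℂ → ℂ) (γ : Path a b) : Prop :=
  CurveIntegrable (fun z => ContinuousLinearMap.toSpanSingleton ℂ (f z)) γ

/-- The winding number of the closed path `γ` about the point `w`
(for a simple loop and `w` off the loop: `0` outside, `1` inside if the loop is anticlockwise,
`-1` inside if it is clockwise). -/
def windingNumber {a : ℂ} (γ : Path a a) (w : ℂ) : ℂ :=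
  (2 * (Real.pi : ℂ) * Complex.I)⁻¹ * contourIntegral (fun z => (z - w)⁻¹) γ

/-- `w` is a pole of the meromorphic function `f` (the value of `f` at `w` is irrelevant). -/
def IsPole (f : ℂ → ℂ) (w : ℂ) : Prop := meromorphicOrderAt f w < 0

/-- `γ` is an admissible integration path `Γ₀` for the integrand `f`: a simple piecewise `C¹`
loop, oriented anticlockwise, that encloses `0` and neither meets nor encloses any other
pole of `f`. -/
structure IsLoopAroundZero (f : ℂ → ℂ) {a : ℂ} (γ : Path a a) : Prop where
  piecewiseC1 : IsPiecewiseC1 γ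
  simple : Set.InjOn γ.extend (Set.Ico 0 1)
  zero_notMem : (0 : ℂ) ∉ Set.range γ
  windingNumber_zero : windingNumber γ 0 = 1
  pole_notMem : ∀ w, IsPole f w → w ∉ Set.range γ
  windingNumber_pole : ∀ w, w ≠ 0 → IsPole f w → windingNumber γ w = 0

/-! ### The kernel for particles starting from `dℤ` -/

/-- The binomial coefficient with integer entries, equal to `0` unless `0 ≤ k ≤ m`. -/
def binom (m k : ℤ) : ℕ :=
  if 0 ≤ k ∧ k ≤ m then Nat.choose m.toNat k.toNat else 0

/-- The roots `u₁(v), …, u_{d-1}(v)` of the equation `u (1 + u)^(d-1) = v (1 + v)^(d-1)` in `u`,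
with multiplicity: all `d` complex roots, with one copy of the trivial root `u₀(v) = v` removed. -/
def nontrivialRoots (d : ℕ) (v : ℂ) : Multiset ℂ :=
  ((Polynomial.X * (1 + Polynomial.X) ^ (d - 1) -
    Polynomial.C (v * (1 + v) ^ (d - 1)) : Polynomial ℂ).roots).erase v

/-- The integrand of the main part `K₀` of the kernel, for jump probability `p` at time `t`. -/
def integrand (d : ℕ) (p : ℝ) (t : ℕ) (n₁ x₁ n₂ x₂ : ℤ) (v : ℂ) : ℂ :=
  ((nontrivialRoots d v).map fun u =>
    (1 + (d : ℂ) * v) / (1 + (d : ℂ) * u) *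
      (((1 + (p : ℂ) * u) ^ t * (-u) ^ n₁ * (1 + v) ^ (x₂ + n₂ - 2)) /
        ((1 + (p : ℂ) * v) ^ t * (-v) ^ n₂ * (1 + u) ^ (x₁ + n₁ - 1)))).sum

/-- The main part `K₀(n₁,x₁;n₂,x₂)` of the kernel, computed along the loop `γ`. -/
def mainPart (d : ℕ) (p : ℝ) (t : ℕ) {a : ℂ} (γ : Path a a) (n₁ x₁ n₂ x₂ : ℤ) : ℂ :=
  1 / (2 * (Real.pi : ℂ) * Complex.I) * contourIntegral (integrand d p t n₁ x₁ n₂ x₂) γ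

/-- The kernel `K(n₁,x₁;n₂,x₂)` at time `t` of the discrete-time TASEP with sequential update,
jump probability `p` and the `d`-periodic initial configuration `x_k(0) = -d (k - 1)`, `k ∈ ℤ`,
with `K₀` computed along the loop `γ`. -/
def kernel (d : ℕ) (p : ℝ) (t : ℕ) {a : ℂ} (γ : Path a a) (n₁ x₁ n₂ x₂ : ℤ) : ℂ :=
  -(binom (x₁ - x₂ - 1) (n₂ - n₁ - 1) : ℂ) + mainPart d p t γ n₁ x₁ n₂ x₂

/-- The integrand of the single contour integral in the case `d = 2`. -/
def integrandTwo (p : ℝ) (t : ℕ) (n₁ x₁ n₂ x₂ : ℤ) (v : ℂ) : ℂ :=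
  (1 + v) ^ (x₂ + n₁ + n₂ - 2) / (-v) ^ (x₁ + n₁ + n₂ - 1) *
    ((1 - (p : ℂ) - (p : ℂ) * v) / (1 + (p : ℂ) * v)) ^ t

end

end TasepKernel

/-!
For `d = 2` the only non-trivial root is `u = -1 - v`, so `-u = 1 + v`, `1 + u = -v` and
`(1 + 2 v) / (1 + 2 u) = -1`: off the three points `0`, `-1`, `-1 / 2` the integrand of `K₀` is the
negative of `integrandTwo` (`integrand_two_eqOn`). At these points the two may differ, because of
division by zero, but this changes neither the poles (`IsPole.congr_finite`) nor the integral along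
a simple loop, which passes through them at finitely many times
(`contourIntegral_congr_finite`).

It remains to see that the integral of `integrandTwo` is the same for all admissible loops. This
function is rational, with poles among `0`, `-1`, `-1 / p` (`integrandTwo_eq_ratFun`). By partial
fractions it is the sum of a derivative, which integrates to zero along a closed path, and of
multiples of `1 / (v - w)`, one for each pole `w` (`exists_primitive_ratFun`). The integrals of the
latter are winding numbers, prescribed by the definition of an admissible loop: `1` about `0`, and
`0` about the other poles. Hence the integral is `2πi` times the residue at `0`
(`exists_contourIntegral_ratFun_eq`), without any appeal to the Jordan curve theorem. The point is
that every zero of the denominator other than `0` is a genuine pole (`isPole_poleLocus`), as the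
loop may meet or enclose any other point. The circle of radius `1 / 2` about `0` is an admissible
loop.
-/

namespace TasepKernel

open MeasureTheory Set Polynomial

/-! ### Contour integrals along piecewise `C¹` paths -/

theorem curveIntegralFun_toSpanSingleton {a b : ℂ} (f : ℂ → ℂ) (γ : Path a b) (t : ℝ) :
    curveIntegralFun (fun z => ContinuousLinearMap.toSpanSingleton ℂ (f z)) γ t =
      derivWithin γ.extend unitInterval t * f (γ.extend t) := by
  rw [curveIntegralFun_def]
  simp

theorem contourIntegral_eq_integral {a b : ℂ} (f : ℂ → ℂ) (γ : Path a b) :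
    contourIntegral f γ =
      ∫ t in (0 : ℝ)..1, derivWithin γ.extend unitInterval t * f (γ.extend t) := by
  rw [contourIntegral, curveIntegral_def]
  simp only [curveIntegralFun_toSpanSingleton]

theorem contourIntegrable_iff {a b : ℂ} {f : ℂ → ℂ} {γ : Path a b} :
    ContourIntegrable f γ ↔ IntervalIntegrable
      (fun t => derivWithin γ.extend unitInterval t * f (γ.extend t)) volume 0 1 := by
  rw [ContourIntegrable, CurveIntegrable]
  exact iff_of_eq (congrArg (IntervalIntegrable · volume 0 1)
    (funext (curveIntegralFun_toSpanSingleton f γ)))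

theorem contourIntegral_const_mul {a b : ℂ} (c : ℂ) (f : ℂ → ℂ) (γ : Path a b) :
    contourIntegral (fun z => c * f z) γ = c * contourIntegral f γ := by
  simp only [contourIntegral_eq_integral, ← intervalIntegral.integral_const_mul]
  congr 1 with t
  ring

theorem contourIntegral_add {a b : ℂ} {f g : ℂ → ℂ} {γ : Path a b}
    (hf : ContourIntegrable f γ) (hg : ContourIntegrable g γ) :
    contourIntegral (fun z => f z + g z) γ = contourIntegral f γ + contourIntegral g γ := by
  rw [contourIntegrable_iff] at hf hg
  simp only [contourIntegral_eq_integral, mul_add]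
  exact intervalIntegral.integral_add hf hg

theorem contourIntegral_congr {a b : ℂ} {f g : ℂ → ℂ} {γ : Path a b}
    (h : EqOn f g (range γ)) : contourIntegral f γ = contourIntegral g γ := by
  simp only [contourIntegral_eq_integral]
  refine intervalIntegral.integral_congr fun t _ => ?_
  have : γ.extend t ∈ range γ := by rw [← γ.extend_range]; exact mem_range_self t
  simp only [h this]

theorem contourIntegral_finsetSum {a b : ℂ} {ι : Type*} (s : Finset ι) {f : ι → ℂ → ℂ}
    {γ : Path a b} (h : ∀ i ∈ s, ContourIntegrable (f i) γ) :
    contourIntegral (fun z => ∑ i ∈ s, f i z) γ = ∑ i ∈ s, contourIntegral (f i) γ := by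
  simp only [contourIntegrable_iff] at h
  simp only [contourIntegral_eq_integral, Finset.mul_sum]
  exact intervalIntegral.integral_finsetSum h

theorem IsPiecewiseC1.intervalIntegrable {a b : ℂ} {γ : Path a b} (hγ : IsPiecewiseC1 γ)
    {g : ℝ → ℂ} (hg : Continuous g) :
    IntervalIntegrable (fun t => derivWithin γ.extend unitInterval t * g t) volume 0 1 := by
  obtain ⟨N, s, hs, h0, h1, hd⟩ := hγ
  rw [← h0, ← h1]
  refine IntervalIntegrable.trans_iterate fun i hi => ?_
  obtain heq | hlt := (hs i.le_succ).eq_or_lt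
  · rw [heq]
  have hsub : Icc (s i) (s (i + 1)) ⊆ unitInterval := by
    refine Icc_subset_Icc ?_ ?_
    · rw [← h0]; exact hs i.zero_le
    · rw [← h1]; exact hs hi
  have hc : ContinuousOn (fun t => derivWithin γ.extend (Icc (s i) (s (i + 1))) t * g t)
      (Icc (s i) (s (i + 1))) :=
    ((hd i hi).continuousOn_derivWithin (uniqueDiffOn_Icc hlt) le_rfl).mul hg.continuousOn
  have hint := (hc.mono (uIcc_of_le hlt.le).subset).intervalIntegrable (μ := volume)
  refine hint.congr_ae ?_
  rw [uIoc_of_le hlt.le, ← restrict_Ioo_eq_restrict_Ioc]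
  filter_upwards [ae_restrict_mem measurableSet_Ioo] with t ht
  have hn := Icc_mem_nhds ht.1 ht.2
  rw [derivWithin_of_mem_nhds hn, derivWithin_of_mem_nhds (Filter.mem_of_superset hn hsub)]

/-- The derivative within `[0, 1]` is a two-sided derivative except at the break points. -/
theorem IsPiecewiseC1.exists_countable_hasDerivAt {a b : ℂ} {γ : Path a b}
    (hγ : IsPiecewiseC1 γ) : ∃ s : Set ℝ, s.Countable ∧ ∀ t ∈ Ioo (0 : ℝ) 1 \ s,
      HasDerivAt γ.extend (derivWithin γ.extend unitInterval t) t := by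
  obtain ⟨N, s, hs, h0, h1, hd⟩ := hγ
  refine ⟨range s, countable_range s, fun t ⟨ht, hts⟩ => ?_⟩
  have key : ∃ i < N, t ∈ Ioo (s i) (s (i + 1)) := by
    by_contra! hcon
    have : ∀ i ≤ N, s i < t := by
      intro i
      induction i with
      | zero => intro _; rw [h0]; exact ht.1
      | succ i ih =>
        intro hi
        have hle : s (i + 1) ≤ t := not_lt.1 fun h => hcon i hi ⟨ih (by omega), h⟩
        exact hle.lt_of_ne fun h => hts ⟨_, h⟩
    exact absurd (this N le_rfl) (by rw [h1]; exact ht.2.not_gt)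
  obtain ⟨i, hi, hti⟩ := key
  have hn := Icc_mem_nhds hti.1 hti.2
  have hdiff := ((hd i hi).differentiableOn one_ne_zero).differentiableAt hn
  rw [derivWithin_of_mem_nhds (Icc_mem_nhds ht.1 ht.2)]
  exact hdiff.hasDerivAt

theorem continuous_comp_extend {a b : ℂ} {γ : Path a b} {f : ℂ → ℂ}
    (hf : ContinuousOn f (range γ)) : Continuous fun t => f (γ.extend t) :=
  hf.comp_continuous γ.continuous_extend fun t => by
    rw [← γ.extend_range]; exact mem_range_self t

theorem IsPiecewiseC1.contourIntegrable {a b : ℂ} {γ : Path a b} (hγ : IsPiecewiseC1 γ)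
    {f : ℂ → ℂ} (hf : ContinuousOn f (range γ)) : ContourIntegrable f γ :=
  contourIntegrable_iff.2 (hγ.intervalIntegrable (continuous_comp_extend hf))

/-- A continuous function with a primitive along a piecewise `C¹` loop integrates to zero. -/
theorem IsPiecewiseC1.contourIntegral_eq_zero {a : ℂ} {γ : Path a a} (hγ : IsPiecewiseC1 γ)
    {f F : ℂ → ℂ} (hf : ContinuousOn f (range γ)) (hF : ∀ z ∈ range γ, HasDerivAt F (f z) z) :
    contourIntegral f γ = 0 := by
  obtain ⟨s, hs, hd⟩ := hγ.exists_countable_hasDerivAt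
  have hmem (t : ℝ) : γ.extend t ∈ range γ := by rw [← γ.extend_range]; exact mem_range_self t
  have hFc : ContinuousOn F (range γ) := fun z hz => (hF z hz).continuousAt.continuousWithinAt
  rw [contourIntegral_eq_integral, integral_eq_of_hasDerivAt_off_countable_of_le
    (fun t => F (γ.extend t)) _ zero_le_one hs (continuous_comp_extend hFc).continuousOn
    (fun t ht => ?_) (contourIntegrable_iff.1 (hγ.contourIntegrable hf))]
  · simp
  · exact ((hF _ (hmem t)).comp t (hd t ht)).congr_deriv (mul_comm _ _)

/-! ### Primitives of rational functions up to simple poles -/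

/-- The rational function `N / ∏ i, (X - w i) ^ n i`. -/
noncomputable def ratFun {ι : Type*} [Fintype ι] (w : ι → ℂ) (n : ι → ℕ) (N : ℂ[X]) (z : ℂ) : ℂ :=
  N.eval z / ∏ i, (z - w i) ^ n i

theorem hasDerivAt_zpow_sub {w z : ℂ} (h : z ≠ w) {m : ℤ} (hm : m ≠ 0) :
    HasDerivAt (fun x => (x - w) ^ m / m) ((z - w) ^ (m - 1)) z := by
  have h1 := (hasDerivAt_zpow m (z - w) (Or.inl (sub_ne_zero.2 h))).comp z
    ((hasDerivAt_id z).sub_const w)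
  have h2 := h1.div_const (m : ℂ)
  have hm' : (m : ℂ) ≠ 0 := by exact_mod_cast hm
  refine h2.congr_deriv ?_
  field_simp

theorem exists_hasDerivAt_polynomial (q : ℂ[X]) : ∃ Q : ℂ → ℂ, ∀ z, HasDerivAt Q (q.eval z) z := by
  induction q using Polynomial.induction_on' with
  | add p q hp hq =>
    obtain ⟨P, hP⟩ := hp
    obtain ⟨Q, hQ⟩ := hq
    exact ⟨P + Q, fun z => by simpa using (hP z).add (hQ z)⟩
  | monomial n c =>
    refine ⟨fun z => c * (z ^ (n + 1) / ((n + 1 : ℕ) : ℂ)), fun z => ?_⟩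
    have hn : ((n + 1 : ℕ) : ℂ) ≠ 0 := by exact_mod_cast n.succ_ne_zero
    refine (((hasDerivAt_pow (n + 1) z).div_const _).const_mul c).congr_deriv ?_
    rw [eval_monomial]
    field_simp
    simp

theorem prod_sub_pow_ne_zero {ι : Type*} (s : Finset ι) {w : ι → ℂ} {n : ι → ℕ} {z : ℂ}
    (hz : ∀ i ∈ s, n i ≠ 0 → z ≠ w i) : ∏ i ∈ s, (z - w i) ^ n i ≠ 0 :=
  Finset.prod_ne_zero_iff.2 fun i hi => by
    by_cases h : n i = 0
    · simp [h]
    · exact pow_ne_zero _ (sub_ne_zero.2 (hz i hi h))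

/-- Partial fractions, read as an integration formula: off its poles, a rational function is the
sum of a derivative and of simple fractions with these poles. -/
theorem exists_primitive_ratFun {ι : Type*} [Fintype ι] {w : ι → ℂ} (hw : Function.Injective w)
    (n : ι → ℕ) (N : ℂ[X]) : ∃ (F : ℂ → ℂ) (c : ι → ℂ), (∀ i, n i = 0 → c i = 0) ∧
      ∀ z, (∀ i, n i ≠ 0 → z ≠ w i) →
        HasDerivAt F (ratFun w n N z - ∑ i, c i * (z - w i)⁻¹) z := by
  classical
  obtain ⟨q, r, hr, hN⟩ := eq_quo_mul_prod_pow_add_sum_rem_mul_prod_pow (s := Finset.univ) N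
    (fun i _ => monic_X_sub_C (w i)) (fun i _ j _ hij => isCoprime_X_sub_C_of_isUnit_sub
      (sub_ne_zero.2 (hw.ne hij)).isUnit) n
  have hrC (i : ι) (j : Fin (n i)) : ∃ a : ℂ, r i j = C a := by
    have := hr i (Finset.mem_univ i) j
    rw [degree_X_sub_C] at this
    exact ⟨_, eq_C_of_degree_le_zero (Nat.WithBot.lt_one_iff_le_zero.1 this)⟩
  choose a ha using hrC
  obtain ⟨Q, hQ⟩ := exists_hasDerivAt_polynomial q
  -- The summand `a i j / (z - w i) ^ (n i - j)` has a primitive unless `j + 1 = n i`.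
  refine ⟨fun z => Q z + ∑ i, ∑ j : Fin (n i), if (j : ℕ) + 1 = n i then 0 else
      a i j * ((z - w i) ^ ((j : ℤ) - n i + 1) / ((j : ℤ) - n i + 1 : ℤ)),
    fun i => ∑ j : Fin (n i), if (j : ℕ) + 1 = n i then a i j else 0, ?_, fun z hz => ?_⟩
  · intro i hi
    have : IsEmpty (Fin (n i)) := by rw [hi]; infer_instance
    simp
  have hval : ratFun w n N z =
      q.eval z + ∑ i, ∑ j : Fin (n i), a i j * (z - w i) ^ ((j : ℤ) - n i) := by
    have hprod := prod_sub_pow_ne_zero Finset.univ fun i _ => hz i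
    rw [ratFun, div_eq_iff hprod]
    conv_lhs => rw [hN]
    simp only [eval_add, eval_mul, eval_finsetSum, eval_prod, eval_pow, eval_sub, eval_X, eval_C,
      ha, add_mul, Finset.sum_mul]
    congr 1
    refine Finset.sum_congr rfl fun i _ => Finset.sum_congr rfl fun j _ => ?_
    have hi : z - w i ≠ 0 := sub_ne_zero.2 (hz i (by have := j.2; omega))
    rw [← Finset.mul_prod_erase _ _ (Finset.mem_univ i), zpow_sub₀ hi]
    simp only [zpow_natCast]
    field_simp
  have hsum : HasDerivAt (fun z => ∑ i, ∑ j : Fin (n i), if (j : ℕ) + 1 = n i then 0 else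
      a i j * ((z - w i) ^ ((j : ℤ) - n i + 1) / ((j : ℤ) - n i + 1 : ℤ)))
      (∑ i, ∑ j : Fin (n i), if (j : ℕ) + 1 = n i then 0 else
        a i j * (z - w i) ^ ((j : ℤ) - n i)) z := by
    refine HasDerivAt.fun_sum fun i _ => HasDerivAt.fun_sum fun j _ => ?_
    split_ifs with h
    · exact hasDerivAt_const z 0
    · have := (hasDerivAt_zpow_sub (hz i (by have := j.2; omega))
        (m := (j : ℤ) - n i + 1) (by omega)).const_mul (a i j)
      simpa using this
  refine ((hQ z).add hsum).congr_deriv ?_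
  rw [hval, add_sub_assoc, ← Finset.sum_sub_distrib]
  congr 1
  refine Finset.sum_congr rfl fun i _ => ?_
  rw [Finset.sum_mul, ← Finset.sum_sub_distrib]
  refine Finset.sum_congr rfl fun j _ => ?_
  split_ifs with h
  · have : (j : ℤ) - n i = -1 := by omega
    rw [this, zpow_neg_one, sub_self]
  · ring

theorem analyticAt_ratFun {ι : Type*} [Fintype ι] {w : ι → ℂ} {n : ι → ℕ} (N : ℂ[X]) {z : ℂ}
    (hz : ∀ i, n i ≠ 0 → z ≠ w i) : AnalyticAt ℂ (ratFun w n N) z := by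
  have h : AnalyticAt ℂ (fun z => ∏ i, (z - w i) ^ n i) z := by fun_prop
  exact (AnalyticAt.aeval_polynomial analyticAt_id N).div h
    (prod_sub_pow_ne_zero _ fun i _ => hz i)

/-- A zero of the denominator is a pole as soon as the numerator does not vanish there. -/
theorem isPole_ratFun {ι : Type*} [Fintype ι] {w : ι → ℂ} (hw : Function.Injective w) {n : ι → ℕ}
    {N : ℂ[X]} {i : ι} (hi : n i ≠ 0) (hN : N.eval (w i) ≠ 0) : IsPole (ratFun w n N) (w i) := by
  classical
  have hm : MeromorphicAt (ratFun w n N) (w i) := by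
    have h : AnalyticAt ℂ (fun z => ∏ i, (z - w i) ^ n i) (w i) := by fun_prop
    exact (AnalyticAt.aeval_polynomial analyticAt_id N).meromorphicAt.div h.meromorphicAt
  have hne : ∏ j ∈ Finset.univ.erase i, (w i - w j) ^ n j ≠ 0 :=
    prod_sub_pow_ne_zero _ fun j hj _ => hw.ne (Finset.ne_of_mem_erase hj).symm
  have hord : meromorphicOrderAt (ratFun w n N) (w i) = (-(n i : ℤ) : ℤ) := by
    refine (meromorphicOrderAt_eq_int_iff hm).2
      ⟨fun z => N.eval z / ∏ j ∈ Finset.univ.erase i, (z - w j) ^ n j, ?_, div_ne_zero hN hne, ?_⟩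
    · have h : AnalyticAt ℂ (fun z => ∏ j ∈ Finset.univ.erase i, (z - w j) ^ n j) (w i) := by
        fun_prop
      exact (AnalyticAt.aeval_polynomial analyticAt_id N).div h hne
    · refine Filter.Eventually.of_forall fun z => ?_
      rw [ratFun, ← Finset.mul_prod_erase _ _ (Finset.mem_univ i), zpow_neg, zpow_natCast,
        smul_eq_mul, div_mul_eq_div_div]
      ring
  rw [IsPole, hord]
  exact_mod_cast (by omega : -(n i : ℤ) < 0)

/-- The residue theorem for a rational function and an admissible loop about `0`: the integral
does not depend on the loop. -/
theorem exists_contourIntegral_ratFun_eq {ι : Type*} [Fintype ι] {w : ι → ℂ}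
    (hw : Function.Injective w) {n : ι → ℕ} {N : ℂ[X]}
    (hpole : ∀ i, w i ≠ 0 → n i ≠ 0 → IsPole (ratFun w n N) (w i)) :
    ∃ c : ℂ, ∀ (a : ℂ) (γ : Path a a), IsLoopAroundZero (ratFun w n N) γ →
      ContourIntegrable (ratFun w n N) γ ∧ contourIntegral (ratFun w n N) γ = c := by
  classical
  obtain ⟨F, c, hc, hF⟩ := exists_primitive_ratFun hw n N
  -- Only the simple fraction at `0` contributes: `2πi` times its coefficient, the residue at `0`.
  refine ⟨∑ i, c i * (2 * (Real.pi : ℂ) * Complex.I * if w i = 0 then 1 else 0),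
    fun a γ hγ => ?_⟩
  have hoff : ∀ z ∈ range γ, ∀ i, n i ≠ 0 → z ≠ w i := by
    rintro z hz i hi rfl
    by_cases h0 : w i = 0
    · exact hγ.zero_notMem (h0 ▸ hz)
    · exact hγ.pole_notMem _ (hpole i h0 hi) hz
  have hcont : ContinuousOn (ratFun w n N) (range γ) := fun z hz =>
    (analyticAt_ratFun N (hoff z hz)).continuousAt.continuousWithinAt
  have hcont' (i : ι) : ContinuousOn (fun z => c i * (z - w i)⁻¹) (range γ) := by
    by_cases hi : n i = 0
    · simpa [hc i hi] using continuousOn_const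
    · exact continuousOn_const.mul (ContinuousOn.inv₀ (by fun_prop)
        fun z hz => sub_ne_zero.2 (hoff z hz i hi))
  have hcs : ContinuousOn (fun z => ∑ i, c i * (z - w i)⁻¹) (range γ) :=
    continuousOn_finsetSum _ fun i _ => hcont' i
  have hcd : ContinuousOn (fun z => ratFun w n N z - ∑ i, c i * (z - w i)⁻¹) (range γ) :=
    hcont.sub hcs
  have hint := hγ.piecewiseC1.contourIntegrable hcont
  refine ⟨hint, ?_⟩
  have hsplit : contourIntegral (ratFun w n N) γ =
      contourIntegral (fun z => (ratFun w n N z - ∑ i, c i * (z - w i)⁻¹) +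
        ∑ i, c i * (z - w i)⁻¹) γ := contourIntegral_congr fun z _ => by ring
  rw [hsplit, contourIntegral_add (hγ.piecewiseC1.contourIntegrable hcd)
    (hγ.piecewiseC1.contourIntegrable hcs),
    hγ.piecewiseC1.contourIntegral_eq_zero hcd fun z hz => hF z (hoff z hz),
    zero_add, contourIntegral_finsetSum _ fun i _ => hγ.piecewiseC1.contourIntegrable (hcont' i)]
  refine Finset.sum_congr rfl fun i _ => ?_
  rw [contourIntegral_const_mul]
  by_cases hi : n i = 0
  · simp [hc i hi]
  have hwind : windingNumber γ (w i) = if w i = 0 then 1 else 0 := by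
    split_ifs with h0
    · rw [h0, hγ.windingNumber_zero]
    · exact hγ.windingNumber_pole _ h0 (hpole i h0 hi)
  rw [← hwind, windingNumber, mul_inv_cancel_left₀ Complex.two_pi_I_ne_zero]

/-! ### Circles as admissible loops -/

/-- The circle of radius `r` about `0`, traversed once anticlockwise from `r`, as a path on
`[0, 1]`. -/
noncomputable def circlePath (r : ℝ) : Path (r : ℂ) (r : ℂ) where
  toFun t := circleMap 0 r (2 * Real.pi * t)
  continuous_toFun := by fun_prop
  source' := by simp [circleMap]
  target' := by simp [circleMap]

theorem circlePath_extend {r t : ℝ} (ht : t ∈ Icc (0 : ℝ) 1) :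
    (circlePath r).extend t = circleMap 0 r (2 * Real.pi * t) := by
  rw [Path.extend_apply _ ht]
  rfl

theorem norm_of_mem_range_circlePath {r : ℝ} (hr : 0 < r) {z : ℂ} (hz : z ∈ range (circlePath r)) :
    ‖z‖ = r := by
  obtain ⟨t, rfl⟩ := hz
  change ‖circleMap 0 r (2 * Real.pi * t)‖ = r
  simp [abs_of_pos hr]

theorem isPiecewiseC1_circlePath (r : ℝ) : IsPiecewiseC1 (circlePath r) := by
  refine ⟨1, fun i => i, Nat.mono_cast, by simp, by simp, fun i hi => ?_⟩
  obtain rfl : i = 0 := by omega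
  have h : ContDiff ℝ 1 fun t : ℝ => circleMap 0 r (2 * Real.pi * t) :=
    (contDiff_circleMap 0 r).comp (contDiff_const.mul contDiff_id)
  refine h.contDiffOn.congr fun t ht => circlePath_extend ?_
  simpa using ht

theorem injOn_circlePath {r : ℝ} (hr : 0 < r) : InjOn (circlePath r).extend (Ico 0 1) := by
  intro s hs t ht h
  rw [circlePath_extend (Ico_subset_Icc_self hs), circlePath_extend (Ico_subset_Icc_self ht)] at h
  have hmem {x : ℝ} (hx : x ∈ Ico (0 : ℝ) 1) :
      2 * Real.pi * x ∈ Ico 0 (2 * Real.pi) :=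
    ⟨mul_nonneg Real.two_pi_pos.le hx.1, mul_lt_of_lt_one_right Real.two_pi_pos hx.2⟩
  exact mul_left_cancel₀ Real.two_pi_pos.ne'
    (injOn_circleMap_of_abs_sub_le' hr.ne' (by simp) (hmem hs) (hmem ht) h)

theorem contourIntegral_circlePath (r : ℝ) (f : ℂ → ℂ) :
    contourIntegral f (circlePath r) = ∮ z in C(0, r), f z := by
  have h : contourIntegral f (circlePath r) = ∫ t in (0 : ℝ)..1, (2 * Real.pi : ℝ) •
      (deriv (circleMap 0 r) (2 * Real.pi * t) • f (circleMap 0 r (2 * Real.pi * t))) := by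
    rw [contourIntegral_eq_integral]
    refine intervalIntegral.integral_congr fun t ht => ?_
    rw [uIcc_of_le zero_le_one] at ht
    have hd : HasDerivWithinAt (circlePath r).extend
        ((2 * Real.pi : ℝ) • deriv (circleMap 0 r) (2 * Real.pi * t)) unitInterval t := by
      have h1 := (differentiable_circleMap 0 r (2 * Real.pi * t)).hasDerivAt.scomp t
        ((hasDerivAt_id t).const_mul (2 * Real.pi))
      rw [mul_one] at h1
      exact h1.hasDerivWithinAt.congr (fun s hs => circlePath_extend hs) (circlePath_extend ht)
    simp only [hd.derivWithin (uniqueDiffOn_Icc_zero_one t ht), circlePath_extend ht, smul_eq_mul,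
      smul_mul_assoc]
  rw [h, intervalIntegral.integral_smul, circleIntegral,
    intervalIntegral.smul_integral_comp_mul_left
      (fun θ => deriv (circleMap 0 r) θ • f (circleMap 0 r θ))]
  simp

theorem windingNumber_circlePath_zero {r : ℝ} (hr : 0 < r) : windingNumber (circlePath r) 0 = 1 := by
  rw [windingNumber, contourIntegral_circlePath, circleIntegral.integral_sub_center_inv 0 hr.ne',
    inv_mul_cancel₀ Complex.two_pi_I_ne_zero]

theorem windingNumber_circlePath_of_lt {r : ℝ} (hr : 0 < r) {w : ℂ} (hw : r < ‖w‖) :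
    windingNumber (circlePath r) w = 0 := by
  have hne {z : ℂ} (hz : z ∈ Metric.closedBall (0 : ℂ) r) : z - w ≠ 0 := by
    rintro h
    rw [sub_eq_zero.1 h, mem_closedBall_zero_iff] at hz
    exact hz.not_gt hw
  have hd : DifferentiableOn ℂ (fun z => (z - w)⁻¹) (Metric.closedBall 0 r) := fun z hz =>
    ((differentiableAt_id.sub_const w).inv (hne hz)).differentiableWithinAt
  rw [windingNumber, contourIntegral_circlePath,
    (hd.diffContOnCl_ball subset_rfl).circleIntegral_eq_zero hr.le, mul_zero]

theorem isLoopAroundZero_circlePath {f : ℂ → ℂ} {r : ℝ} (hr : 0 < r)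
    (hf : ∀ w, w ≠ 0 → IsPole f w → r < ‖w‖) : IsLoopAroundZero f (circlePath r) where
  piecewiseC1 := isPiecewiseC1_circlePath r
  simple := injOn_circlePath hr
  zero_notMem h := hr.ne (by simpa using norm_of_mem_range_circlePath hr h)
  windingNumber_zero := windingNumber_circlePath_zero hr
  pole_notMem w hw h := by
    have hn := norm_of_mem_range_circlePath hr h
    have h0 : w ≠ 0 := by
      rintro rfl
      exact hr.ne (by simpa using hn)
    exact (hf w h0 hw).ne' hn
  windingNumber_pole w h0 hw := windingNumber_circlePath_of_lt hr (hf w h0 hw)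

/-! ### Integrands that agree off a finite set -/

theorem IsPole.congr_finite {f g : ℂ → ℂ} {S : Set ℂ} (hS : S.Finite) (h : EqOn f g Sᶜ) {w : ℂ}
    (hf : IsPole f w) : IsPole g w := by
  have hn : f =ᶠ[nhdsWithin w {w}ᶜ] g := by
    have hmem : (S \ {w})ᶜ ∈ nhds w := hS.sdiff.isClosed.isOpen_compl.mem_nhds (by simp)
    filter_upwards [nhdsWithin_le_nhds hmem, self_mem_nhdsWithin] with z hz hzw
    exact h fun hzS => hz ⟨hzS, hzw⟩
  rwa [IsPole, ← meromorphicOrderAt_congr hn]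

theorem isPole_neg {f : ℂ → ℂ} {w : ℂ} : IsPole (fun z => -f z) w ↔ IsPole f w := by
  rw [IsPole, IsPole, ← meromorphicOrderAt_fun_neg]

theorem IsLoopAroundZero.mono {f g : ℂ → ℂ} {a : ℂ} {γ : Path a a} (hγ : IsLoopAroundZero f γ)
    (h : ∀ w, IsPole g w → IsPole f w) : IsLoopAroundZero g γ where
  piecewiseC1 := hγ.piecewiseC1
  simple := hγ.simple
  zero_notMem := hγ.zero_notMem
  windingNumber_zero := hγ.windingNumber_zero
  pole_notMem w hw := hγ.pole_notMem w (h w hw)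
  windingNumber_pole w h0 hw := hγ.windingNumber_pole w h0 (h w hw)

/-- A simple loop meets a finite set at finitely many times only, so that two integrands which
agree off this set agree almost everywhere along the loop. -/
theorem ae_comp_extend_eq {a b : ℂ} {γ : Path a b} (hγ : InjOn γ.extend (Ico 0 1))
    {f g : ℂ → ℂ} {S : Set ℂ} (hS : S.Finite) (h : EqOn f g Sᶜ) :
    (fun t => derivWithin γ.extend unitInterval t * f (γ.extend t))
      =ᵐ[volume.restrict (uIoc (0 : ℝ) 1)]
      fun t => derivWithin γ.extend unitInterval t * g (γ.extend t) := by
  have hfin : (Ico (0 : ℝ) 1 ∩ γ.extend ⁻¹' S).Finite :=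
    Finite.of_finite_image (hS.subset (by rintro _ ⟨t, ht, rfl⟩; exact ht.2))
      (hγ.mono inter_subset_left)
  have hae := ae_restrict_of_ae (s := Ico (0 : ℝ) 1) (compl_mem_ae_iff.2 (hfin.measure_zero volume))
  rw [uIoc_of_le zero_le_one, ← restrict_Ico_eq_restrict_Ioc]
  filter_upwards [hae, ae_restrict_mem measurableSet_Ico] with t ht hmem
  rw [h fun hS => ht ⟨hmem, hS⟩]

theorem contourIntegral_congr_finite {a b : ℂ} {γ : Path a b} (hγ : InjOn γ.extend (Ico 0 1))
    {f g : ℂ → ℂ} {S : Set ℂ} (hS : S.Finite) (h : EqOn f g Sᶜ) :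
    contourIntegral f γ = contourIntegral g γ := by
  rw [contourIntegral_eq_integral, contourIntegral_eq_integral]
  exact intervalIntegral.integral_congr_ae_restrict (ae_comp_extend_eq hγ hS h)

theorem ContourIntegrable.congr_finite {a b : ℂ} {γ : Path a b} (hγ : InjOn γ.extend (Ico 0 1))
    {f g : ℂ → ℂ} {S : Set ℂ} (hS : S.Finite) (h : EqOn f g Sᶜ) (hf : ContourIntegrable f γ) :
    ContourIntegrable g γ := by
  rw [contourIntegrable_iff] at hf ⊢
  exact hf.congr_ae (ae_comp_extend_eq hγ hS h)

/-! ### The two integrands for `d = 2` -/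

theorem nontrivialRoots_two (v : ℂ) : nontrivialRoots 2 v = {-1 - v} := by
  have h : (X * (1 + X) ^ (2 - 1) - C (v * (1 + v) ^ (2 - 1)) : ℂ[X]) =
      (X - C v) * (X - C (-1 - v)) := by
    simp only [Nat.add_one_sub_one, pow_one, map_mul, map_add, map_sub, map_neg, map_one]
    ring
  rw [nontrivialRoots, h, roots_mul (mul_ne_zero (X_sub_C_ne_zero _) (X_sub_C_ne_zero _)),
    roots_X_sub_C, roots_X_sub_C, Multiset.singleton_add, Multiset.erase_cons_head]

/-- Off the zeros of `v`, `1 + v` and `1 + 2 v`, the factor `(1 + 2 v) / (1 + 2 u)` with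
`u = -1 - v` is `-1`, and the powers of `-u = 1 + v` and of `1 + u = -v` combine. -/
theorem integrand_two_eqOn (p : ℝ) (t : ℕ) (n₁ x₁ n₂ x₂ : ℤ) :
    EqOn (integrand 2 p t n₁ x₁ n₂ x₂) (fun v => -integrandTwo p t n₁ x₁ n₂ x₂ v)
      ({0, -1, -1 / 2} : Set ℂ)ᶜ := by
  intro v hv
  simp only [mem_compl_iff, mem_insert_iff, mem_singleton_iff, not_or] at hv
  obtain ⟨h0, h1, h2⟩ := hv
  have hv0 : -v ≠ 0 := neg_ne_zero.2 h0
  have hv1 : 1 + v ≠ 0 := fun h => h1 (by linear_combination h)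
  have hv2 : 1 + 2 * v ≠ 0 := fun h => h2 (by linear_combination h / 2)
  have e1 : (1 + 2 * v) / (1 + 2 * (-1 - v)) = -1 := by
    rw [show 1 + 2 * (-1 - v) = -(1 + 2 * v) by ring, div_neg, div_self hv2]
  have e2 : -(-1 - v) = 1 + v := by ring
  have e3 : 1 + (-1 - v) = -v := by ring
  have e4 : 1 + (p : ℂ) * (-1 - v) = 1 - p - p * v := by ring
  have e5 : (1 + v) ^ (x₂ + n₁ + n₂ - 2) = (1 + v) ^ n₁ * (1 + v) ^ (x₂ + n₂ - 2) := by
    rw [← zpow_add₀ hv1]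
    ring_nf
  have e6 : (-v) ^ (x₁ + n₁ + n₂ - 1) = (-v) ^ n₂ * (-v) ^ (x₁ + n₁ - 1) := by
    rw [← zpow_add₀ hv0]
    ring_nf
  simp only [integrand, nontrivialRoots_two, Multiset.map_singleton, Multiset.sum_singleton,
    Nat.cast_ofNat, integrandTwo, e1, e2, e3, e4, e5, e6, div_pow]
  ring

/-- Also valid at `x = 0`, since one of the two exponents on the right vanishes. -/
theorem zpow_eq_pow_toNat_div {K : Type*} [DivisionRing K] (x : K) (m : ℤ) :
    x ^ m = x ^ m.toNat / x ^ (-m).toNat := by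
  obtain h | h := le_total 0 m
  · obtain ⟨k, rfl⟩ := Int.eq_ofNat_of_zero_le h
    simp
  · obtain ⟨k, hk⟩ := Int.eq_ofNat_of_zero_le (neg_nonneg.2 h)
    obtain rfl : m = -k := by omega
    simp

/-- The possible poles of the integrand for `d = 2`. -/
noncomputable def poleLocus (p : ℝ) : Fin 3 → ℂ := ![0, -1, -(p : ℂ)⁻¹]

/-- The multiplicities of `poleLocus p` in the denominator `(-v) ^ m (1 + v) ^ (-k) (1 + p v) ^ t`.
A negative exponent contributes to the numerator `numerator p t k m` instead. -/
def poleMult (t : ℕ) (k m : ℤ) : Fin 3 → ℕ := ![m.toNat, (-k).toNat, t]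

/-- The numerator of `(1 + v) ^ k (-v) ^ (-m) ((1 - p - p v) / (1 + p v)) ^ t`, the integrand for `d = 2`,
for the denominator with monic factors given by `poleLocus` and `poleMult`. -/
noncomputable def numerator (p : ℝ) (t : ℕ) (k m : ℤ) : ℂ[X] :=
  C ((-1) ^ m.toNat / (p : ℂ) ^ t) * (1 + X) ^ k.toNat * (-X) ^ (-m).toNat *
    (C (1 - (p : ℂ)) - C (p : ℂ) * X) ^ t

theorem eval_numerator (p : ℝ) (t : ℕ) (k m : ℤ) (z : ℂ) :
    (numerator p t k m).eval z = (-1) ^ m.toNat / (p : ℂ) ^ t * (1 + z) ^ k.toNat *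
      (-z) ^ (-m).toNat * (1 - (p : ℂ) - p * z) ^ t := by
  simp [numerator]

theorem integrandTwo_eq_ratFun {p : ℝ} (hp : 0 < p) (t : ℕ) (n₁ x₁ n₂ x₂ : ℤ) :
    integrandTwo p t n₁ x₁ n₂ x₂ = ratFun (poleLocus p)
      (poleMult t (x₂ + n₁ + n₂ - 2) (x₁ + n₁ + n₂ - 1))
      (numerator p t (x₂ + n₁ + n₂ - 2) (x₁ + n₁ + n₂ - 1)) := by
  ext z
  have hpc : (p : ℂ) ≠ 0 := by exact_mod_cast hp.ne'
  rw [integrandTwo, ratFun, eval_numerator]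
  generalize x₂ + n₁ + n₂ - 2 = k
  generalize x₁ + n₁ + n₂ - 1 = m
  simp only [poleLocus, poleMult, Fin.prod_univ_three, Matrix.cons_val_zero, Matrix.cons_val_one,
    Matrix.cons_val, sub_zero, sub_neg_eq_add]
  rw [zpow_eq_pow_toNat_div (1 + z) k, zpow_eq_pow_toNat_div (-z) m, div_pow,
    show 1 + (p : ℂ) * z = p * (z + (p : ℂ)⁻¹) by field_simp; ring, mul_pow, neg_pow z m.toNat,
    add_comm z 1]
  have hs : ((-1 : ℂ) ^ m.toNat)⁻¹ = (-1) ^ m.toNat := by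
    rw [← inv_pow, inv_neg_one]
  simp only [div_eq_mul_inv, mul_inv, inv_inv, hs]
  ring

theorem poleLocus_injective {p : ℝ} (hp0 : 0 < p) (hp1 : p < 1) :
    Function.Injective (poleLocus p) := by
  have hpc : (p : ℂ) ≠ 0 := by exact_mod_cast hp0.ne'
  have h1 : (p : ℂ)⁻¹ ≠ 1 := by
    rw [ne_eq, inv_eq_one]
    exact_mod_cast hp1.ne
  intro i j h
  fin_cases i <;> fin_cases j <;> simp_all [poleLocus, eq_comm]

/-- The fraction is reduced away from `0`: every point of `poleLocus p` other than `0` that occurs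
in the denominator is a pole. At `-1 / p` this needs `p ≠ 1` and `p ≠ 2`. -/
theorem isPole_poleLocus {p : ℝ} (hp0 : 0 < p) (hp1 : p < 1) {t : ℕ} {k m : ℤ} {i : Fin 3}
    (hi : poleLocus p i ≠ 0) (hn : poleMult t k m i ≠ 0) :
    IsPole (ratFun (poleLocus p) (poleMult t k m) (numerator p t k m)) (poleLocus p i) := by
  have hpc : (p : ℂ) ≠ 0 := by exact_mod_cast hp0.ne'
  refine isPole_ratFun (poleLocus_injective hp0 hp1) hn ?_
  have hc : (-1 : ℂ) ^ m.toNat / (p : ℂ) ^ t ≠ 0 := by simp [hpc]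
  rw [eval_numerator]
  fin_cases i
  · exact absurd rfl hi
  · have hk : k.toNat = 0 := by
      have : (-k).toNat ≠ 0 := hn
      omega
    simp [poleLocus, hk, hpc]
  · have h1 : (1 : ℂ) + -(p : ℂ)⁻¹ ≠ 0 := by
      rw [← sub_eq_add_neg, sub_ne_zero, ne_comm, ne_eq, inv_eq_one]
      exact_mod_cast hp1.ne
    have h2 : 1 - (p : ℂ) - p * -(p : ℂ)⁻¹ ≠ 0 := by
      rw [mul_neg, mul_inv_cancel₀ hpc]
      exact_mod_cast (by linarith : 1 - p - -1 ≠ 0)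
    exact mul_ne_zero (mul_ne_zero (mul_ne_zero hc (pow_ne_zero _ h1))
      (pow_ne_zero _ (by simpa [poleLocus] using hpc))) (pow_ne_zero _ h2)

/-- Since `p < 1`, the circle of radius `1 / 2` about `0` encloses no pole other than `0`. -/
theorem half_lt_norm_of_isPole {p : ℝ} (hp0 : 0 < p) (hp1 : p < 1) {t : ℕ} {k m : ℤ} {z : ℂ}
    (h0 : z ≠ 0) (hz : IsPole (ratFun (poleLocus p) (poleMult t k m) (numerator p t k m)) z) :
    1 / 2 < ‖z‖ := by
  have hmem : ∃ i, z = poleLocus p i := by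
    by_contra! h
    exact (analyticAt_ratFun _ fun i _ => h i).meromorphicOrderAt_nonneg.not_gt hz
  obtain ⟨i, rfl⟩ := hmem
  fin_cases i
  · exact absurd rfl h0
  · norm_num [poleLocus]
  · have : 1 < p⁻¹ := (one_lt_inv₀ hp0).2 hp1
    simp only [poleLocus, Fin.reduceFinMk, Matrix.cons_val, norm_neg, norm_inv, Complex.norm_real,
      Real.norm_of_nonneg hp0.le]
    linarith

end TasepKernel

theorem corollary2p1 (p : ℝ) (hp0 : 0 < p) (hp1 : p < 1) (t : ℕ) :
    (∀ v : ℂ, TasepKernel.nontrivialRoots 2 v = {-1 - v}) ∧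
    ∀ n₁ x₁ n₂ x₂ : ℤ,
      (∃ (a : ℂ) (γ : Path a a),
        TasepKernel.IsLoopAroundZero (TasepKernel.integrand 2 p t n₁ x₁ n₂ x₂) γ ∧
        TasepKernel.IsLoopAroundZero (TasepKernel.integrandTwo p t n₁ x₁ n₂ x₂) γ) ∧
      ∀ (a b : ℂ) (γ : Path a a) (γ' : Path b b),
        TasepKernel.IsLoopAroundZero (TasepKernel.integrand 2 p t n₁ x₁ n₂ x₂) γ →
        TasepKernel.IsLoopAroundZero (TasepKernel.integrandTwo p t n₁ x₁ n₂ x₂) γ' →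
        TasepKernel.ContourIntegrable (TasepKernel.integrand 2 p t n₁ x₁ n₂ x₂) γ ∧
        TasepKernel.ContourIntegrable (TasepKernel.integrandTwo p t n₁ x₁ n₂ x₂) γ' ∧
        TasepKernel.kernel 2 p t γ n₁ x₁ n₂ x₂ =
          -(TasepKernel.binom (x₁ - x₂ - 1) (n₂ - n₁ - 1) : ℂ) +
            (-1) / (2 * (Real.pi : ℂ) * Complex.I) *
              TasepKernel.contourIntegral (TasepKernel.integrandTwo p t n₁ x₁ n₂ x₂) γ' := by
  refine ⟨TasepKernel.nontrivialRoots_two, fun n₁ x₁ n₂ x₂ => ?_⟩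
  have hfin : ({0, -1, -1 / 2} : Set ℂ).Finite := Set.toFinite _
  have heq := TasepKernel.integrand_two_eqOn p t n₁ x₁ n₂ x₂
  have hpole (w : ℂ) : TasepKernel.IsPole (TasepKernel.integrand 2 p t n₁ x₁ n₂ x₂) w ↔
      TasepKernel.IsPole (TasepKernel.integrandTwo p t n₁ x₁ n₂ x₂) w := by
    rw [← TasepKernel.isPole_neg (f := TasepKernel.integrandTwo p t n₁ x₁ n₂ x₂)]
    exact ⟨.congr_finite hfin heq, .congr_finite hfin heq.symm⟩
  have hrat := TasepKernel.integrandTwo_eq_ratFun hp0 t n₁ x₁ n₂ x₂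
  obtain ⟨c, hc⟩ := TasepKernel.exists_contourIntegral_ratFun_eq
    (TasepKernel.poleLocus_injective hp0 hp1) fun i hi hn =>
      TasepKernel.isPole_poleLocus hp0 hp1 (t := t) (k := x₂ + n₁ + n₂ - 2)
        (m := x₁ + n₁ + n₂ - 1) hi hn
  rw [← hrat] at hc
  have hcircle : TasepKernel.IsLoopAroundZero (TasepKernel.integrandTwo p t n₁ x₁ n₂ x₂)
      (TasepKernel.circlePath (1 / 2)) :=
    TasepKernel.isLoopAroundZero_circlePath (by norm_num) fun w h0 hw =>
      TasepKernel.half_lt_norm_of_isPole hp0 hp1 h0 (hrat ▸ hw)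
  refine ⟨⟨_, _, hcircle.mono fun w hw => (hpole w).1 hw, hcircle⟩, fun a b γ γ' hγ hγ' => ?_⟩
  obtain ⟨hint, hval⟩ := hc a γ (hγ.mono fun w hw => (hpole w).2 hw)
  obtain ⟨hint', hval'⟩ := hc b γ' hγ'
  have hneg := TasepKernel.contourIntegral_const_mul (-1)
    (TasepKernel.integrandTwo p t n₁ x₁ n₂ x₂) γ
  simp only [neg_one_mul] at hneg
  refine ⟨?_, hint', ?_⟩
  · refine TasepKernel.ContourIntegrable.congr_finite hγ.simple hfin heq.symm ?_
    rw [TasepKernel.contourIntegrable_iff] at hint ⊢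
    simp only [mul_neg]
    exact hint.neg
  · rw [TasepKernel.kernel, TasepKernel.mainPart,
      TasepKernel.contourIntegral_congr_finite hγ.simple hfin heq, hneg, hval, hval']
    ring
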